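/- All graphs are finite, simple and undirected. For a graph $H$, let $\mathrm{odd}(H)$ be the number of connected components of $H$ that have an odd number of vertices and more than one vertex, let $i(H)$ be the number of isolated vertices of $H$, and let $\rho(H)$ be the largest eigenvalue of the adjacency matrix of $H$. For an odd integer $k\ge 3$, a $k$-barrier of a graph $G$ is a set $S\subseteq V(G)$ that attains the maximum $$\max_{S\subseteq V(G)}\bigl\{\mathrm{odd}(G-S)+k\cdot i(G-S)-k|S|\bigr\}.$$ A graph $G$ of even order is generalized bicritical ($\mathrm{GBC}_k$) if $\emptyset$ is its only $k$-barrier. Write $G_1+G_2$ for the disjoint union, $G_1\vee G_2$ for the join (the disjoint union together with all edges between $V(G_1)$ and $V(G_2)$), $K_m$ for the complete graph of order $m$, and $mK_1$ for the edgeless graph of order $m$. **Theorem.** Let $n\ge 4$ be even, let $k\ge 3$ be odd, and let $G$ be a connected graph of order $n$. 1. If $n\ge 8$ and $\rho(G)\ge\rho\bigl(K_1\vee(K_{n-2}+K_1)\bigr)$, then $G$ is $\mathrm{GBC}_k$ unless $G\cong K_1\vee(K_{n-2}+K_1)$, and this exceptional graph is not $\mathrm{GBC}_k$. 2. If $n\in\{4,6\}$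 and $\rho(G)\ge\rho\bigl(K_{n/2}\vee\tfrac n2K_1\bigr)$, then $G$ is $\mathrm{GBC}_k$ unless $G\cong K_{n/2}\vee\tfrac n2K_1$, and this exceptional graph is not $\mathrm{GBC}_k$. -/

import Mathlib

namespace GenBicritical

/-- The join `G ∨ H`: the disjoint union of `G` and `H` together with all edges between them. -/
def join {V W : Type*} (G : SimpleGraph V) (H : SimpleGraph W) : SimpleGraph (V ⊕ W) :=
  (G ⊕g H) ⊔ completeBipartiteGraph V W

/-- The number of nontrivial odd components: components with an odd number of vertices,
other than the single-vertex ones. -/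
noncomputable def oddCount {V : Type*} (G : SimpleGraph V) : ℕ :=
  {c : G.ConnectedComponent | c ∈ G.oddComponents ∧ c.supp.Nontrivial}.ncard

/-- The number of isolated vertices. -/
noncomputable def isolatedCount {V : Type*} (G : SimpleGraph V) : ℕ :=
  {v : V | G.IsIsolated v}.ncard

/-- The quantity maximized over `S ⊆ V(G)` in the `k`-Berge–Tutte formula;
`G - S` is the subgraph induced on the complement of `S`. -/
noncomputable def bergeTutte {V : Type*} (k : ℕ) (G : SimpleGraph V) (S : Set V) : ℤ :=
  if Even k then
    (k : ℤ) * isolatedCount (G.induce Sᶜ) - k * S.ncard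
  else
    (oddCount (G.induce Sᶜ) : ℤ) + k * isolatedCount (G.induce Sᶜ) - k * S.ncard

/-- `S` is a `k`-barrier if it attains the maximum in the `k`-Berge–Tutte formula. -/
def IsBarrier {V : Type*} (k : ℕ) (G : SimpleGraph V) (S : Set V) : Prop :=
  ∀ T : Set V, bergeTutte k G T ≤ bergeTutte k G S

/-- Generalized bicritical (`GBC_k`): even order, and `∅` is the only `k`-barrier. -/
def IsGBC {V : Type*} (k : ℕ) (G : SimpleGraph V) : Prop :=
  Even (Nat.card V) ∧ ∀ S : Set V, IsBarrier k G S ↔ S = ∅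

open Classical in
/-- The adjacency spectral radius: the largest (real) eigenvalue of the adjacency matrix. -/
noncomputable def rho {V : Type*} [Fintype V] (G : SimpleGraph V) : ℝ :=
  sSup (spectrum ℝ (G.adjMatrix ℝ))

/-- `K_1 ∨ (K_{n-2} + K_1)`, of order `n` for `n ≥ 2`. -/
abbrev pendantGraph (n : ℕ) : SimpleGraph (Fin 1 ⊕ (Fin (n - 2) ⊕ Fin 1)) :=
  join (⊤ : SimpleGraph (Fin 1)) ((⊤ : SimpleGraph (Fin (n - 2))) ⊕g (⊤ : SimpleGraph (Fin 1)))

/-- `K_{n/2} ∨ (n/2) K_1`, of order `n` for even `n`. -/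
abbrev splitGraph (n : ℕ) : SimpleGraph (Fin (n / 2) ⊕ Fin (n / 2)) :=
  join (⊤ : SimpleGraph (Fin (n / 2))) (⊥ : SimpleGraph (Fin (n / 2)))

end GenBicritical

/-! For connected `G` of even order the empty set has value `0`, so failing to be `GBC_k` means some
nonempty `S` has value at least `0`. Write s = |S|. If `G - S` has at least s isolated vertices,
then s of them form a set `I` with all neighbours in `S`, and `G` is a subgraph of `barrierGraph S
I`. Otherwise the odd components must compensate at rate k ≥ 3, so there are at least three, and `G
- S` splits into two large non-adjacent parts.

Hong's bound ρ² ≤ 2m - n + 1 (here m is the number of edges) turns the spectral hypothesis into an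
edge count. For n ≥ 8, ρ ≥ n - 2 gives 2m ≥ n² - 3n + 3, which the separated case cannot meet and
which allows only s = 1 or n = 8, s = 4. Parity then makes `G` equal to `barrierGraph S I`; the
sporadic K₄ ∨ 4K₁ has ρ < 6 and is discarded. For n = 4, 6 the same count forces s = n/2. -/

namespace GenBicritical

/-! ### Rayleigh, positive-vector and Hong bounds for the spectral radius. -/

section Spectral

open Classical Matrix

variable {V : Type*} [Fintype V]

theorem rho_mem_spectrum [Nonempty V] (G : SimpleGraph V) :
    rho G ∈ spectrum ℝ (G.adjMatrix ℝ) := by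
  have hA := G.isHermitian_adjMatrix ℝ
  refine Set.Nonempty.csSup_mem ?_ finite_real_spectrum
  rw [hA.spectrum_real_eq_range_eigenvalues]
  exact Set.range_nonempty _

theorem exists_rho_eigenvector [Nonempty V] (G : SimpleGraph V) :
    ∃ x : V → ℝ, x ≠ 0 ∧ G.adjMatrix ℝ *ᵥ x = rho G • x := by
  have h := rho_mem_spectrum G
  rw [← Matrix.spectrum_toLin', ← Module.End.hasEigenvalue_iff_mem_spectrum] at h
  obtain ⟨x, hx⟩ := h.exists_hasEigenvector
  exact ⟨x, hx.2, by simpa using hx.apply_eq_smul⟩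

/-- The Rayleigh quotient bounds the spectral radius from below. -/
theorem le_rho_of_rayleigh (G : SimpleGraph V) {c : ℝ} {x : V → ℝ} (hx : x ≠ 0)
    (h : c * (x ⬝ᵥ x) ≤ x ⬝ᵥ (G.adjMatrix ℝ *ᵥ x)) : c ≤ rho G := by
  have hA := G.isHermitian_adjMatrix ℝ
  have hp : (algebraMap ℝ (Matrix V V ℝ) (rho G) - G.adjMatrix ℝ).PosSemidef := by
    rw [Matrix.posSemidef_iff_isHermitian_and_spectrum_nonneg]
    refine ⟨?_, ?_⟩
    · refine IsHermitian.sub ?_ hA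
      rw [Matrix.algebraMap_eq_diagonal]
      exact Matrix.isHermitian_diagonal _
    · rw [← spectrum.singleton_sub_eq]
      rintro _ ⟨a, rfl, b, hb, rfl⟩
      exact sub_nonneg.2 (le_csSup finite_real_spectrum.bddAbove hb)
  have h1 := hp.dotProduct_mulVec_nonneg x
  rw [Matrix.sub_mulVec, dotProduct_sub, Algebra.algebraMap_eq_smul_one, Matrix.smul_mulVec,
    Matrix.one_mulVec, dotProduct_smul] at h1
  simp only [star_trivial, smul_eq_mul] at h1
  have h2 : 0 < x ⬝ᵥ x := by
    have := dotProduct_star_self_pos_iff.2 hx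
    simpa using this
  exact le_of_mul_le_mul_right (by linarith) h2

/-- If a nonnegative matrix `M` satisfies `M y ≤ c y` for a positive vector `y`, then every
real eigenvalue of `M` is at most `c`. -/
theorem eigenvalue_le_of_mulVec_le {M : Matrix V V ℝ} (hM : ∀ i j, 0 ≤ M i j) {y : V → ℝ}
    (hy : ∀ i, 0 < y i) {c : ℝ} (hMy : ∀ i, (M *ᵥ y) i ≤ c * y i) {x : V → ℝ} (hx : x ≠ 0)
    {μ : ℝ} (hμ : M *ᵥ x = μ • x) : μ ≤ c := by
  obtain ⟨j, hj⟩ := Function.ne_iff.1 hx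
  obtain ⟨v, -, hv⟩ := Finset.exists_max_image Finset.univ (fun i => |x i| / y i)
    ⟨j, Finset.mem_univ j⟩
  set t := |x v| / y v with ht
  have hle : ∀ i, |x i| ≤ t * y i := fun i => (div_le_iff₀ (hy i)).1 (hv i (Finset.mem_univ i))
  have hxv : |x v| = t * y v := by rw [ht]; field_simp [(hy v).ne']
  have htpos : 0 < t := lt_of_lt_of_le (div_pos (abs_pos.2 hj) (hy j)) (hv j (Finset.mem_univ j))
  -- At `v` the ratio |x| / y is maximal, so |x| ≤ t y everywhere with equality at `v`; reading the
  -- eigenvalue equation there compares |μ| with `c`.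
  have h1 : |μ| * (t * y v) ≤ c * (t * y v) := by
    calc |μ| * (t * y v) = |(M *ᵥ x) v| := by rw [hμ, ← hxv]; simp [abs_mul]
      _ ≤ ∑ i, |M v i * x i| := by
        simp only [mulVec, dotProduct]; exact Finset.abs_sum_le_sum_abs _ _
      _ ≤ ∑ i, t * (M v i * y i) := by
        refine Finset.sum_le_sum fun i _ => ?_
        rw [abs_mul, abs_of_nonneg (hM v i)]
        calc M v i * |x i| ≤ M v i * (t * y i) := mul_le_mul_of_nonneg_left (hle i) (hM v i)
          _ = _ := by ring
      _ = t * (M *ᵥ y) v := by simp only [mulVec, dotProduct, Finset.mul_sum]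
      _ ≤ t * (c * y v) := mul_le_mul_of_nonneg_left (hMy v) htpos.le
      _ = _ := by ring
  exact (le_abs_self μ).trans (le_of_mul_le_mul_right h1 (mul_pos htpos (hy v)))

theorem adjMatrix_nonneg {V : Type*} (G : SimpleGraph V) (i j : V) : 0 ≤ G.adjMatrix ℝ i j := by
  rw [SimpleGraph.adjMatrix_apply]; split_ifs <;> norm_num

theorem rho_le_of_mulVec_le [Nonempty V] (G : SimpleGraph V) {y : V → ℝ} (hy : ∀ i, 0 < y i)
    {c : ℝ} (h : ∀ i, (G.adjMatrix ℝ *ᵥ y) i ≤ c * y i) : rho G ≤ c := by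
  obtain ⟨x, hx, hxe⟩ := exists_rho_eigenvector G
  exact eigenvalue_le_of_mulVec_le (adjMatrix_nonneg G) hy h hx hxe

/-- In a graph without isolated vertices, the number of walks of length two from any vertex is
at most `2m - n + 1`. -/
theorem sum_neighbor_degree_add_card_le (G : SimpleGraph V) (hd : ∀ v, 1 ≤ G.degree v) (v : V) :
    ∑ u ∈ G.neighborFinset v, G.degree u + Fintype.card V ≤ ∑ u, G.degree u + 1 := by
  have h1 := Finset.sum_add_sum_compl (insert v (G.neighborFinset v)) (fun u => G.degree u)
  rw [Finset.sum_insert (by simp)] at h1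
  -- Each vertex outside the closed neighbourhood of `v` contributes at least one to the total
  -- degree.
  have h2 : (insert v (G.neighborFinset v))ᶜ.card ≤
      ∑ u ∈ (insert v (G.neighborFinset v))ᶜ, G.degree u := by
    simpa using Finset.card_nsmul_le_sum (insert v (G.neighborFinset v))ᶜ
      (fun u => G.degree u) 1 (fun u _ => hd u)
  have h3 := Finset.card_add_card_compl (insert v (G.neighborFinset v))
  rw [Finset.card_insert_of_notMem (by simp), SimpleGraph.card_neighborFinset_eq_degree] at h3
  omega

/-- Hong's bound: `ρ² ≤ 2m - n + 1` for graphs without isolated vertices. -/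
theorem rho_sq_le [Nonempty V] (G : SimpleGraph V) (hd : ∀ v, 1 ≤ G.degree v) :
    rho G ^ 2 ≤ (∑ u, G.degree u : ℕ) - (Fintype.card V : ℝ) + 1 := by
  obtain ⟨x, hx, hxe⟩ := exists_rho_eigenvector G
  have hsq : (G.adjMatrix ℝ * G.adjMatrix ℝ) *ᵥ x = (rho G ^ 2) • x := by
    rw [← Matrix.mulVec_mulVec, hxe, Matrix.mulVec_smul, hxe, smul_smul, sq]
  -- The row sums of A² count walks of length two.
  refine eigenvalue_le_of_mulVec_le (y := fun _ => 1) ?_ (fun _ => one_pos) ?_ hx hsq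
  · intro i j
    rw [Matrix.mul_apply]
    exact Finset.sum_nonneg fun l _ => mul_nonneg (adjMatrix_nonneg G _ _) (adjMatrix_nonneg G _ _)
  · intro v
    rw [← Matrix.mulVec_mulVec, SimpleGraph.adjMatrix_mulVec_apply]
    have h : ∀ u, (G.adjMatrix ℝ *ᵥ fun _ => (1 : ℝ)) u = G.degree u := fun u => by
      rw [SimpleGraph.adjMatrix_mulVec_apply]; simp
    simp only [h, mul_one]
    have := sum_neighbor_degree_add_card_le G hd v
    have h' : ((∑ u ∈ G.neighborFinset v, G.degree u : ℕ) : ℝ) + Fintype.card V ≤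
      (∑ u, G.degree u : ℕ) + 1 := by exact_mod_cast this
    push_cast at h' ⊢
    linarith

end Spectral

/-! ### Adjacency in joins. -/

section Join

variable {V W : Type*} (G : SimpleGraph V) (H : SimpleGraph W)

theorem join_adj_inl_inl (u v : V) : (join G H).Adj (Sum.inl u) (Sum.inl v) ↔ G.Adj u v := by
  simp [join]

theorem join_adj_inr_inr (u v : W) : (join G H).Adj (Sum.inr u) (Sum.inr v) ↔ H.Adj u v := by
  simp [join]

theorem join_adj_inl_inr (u : V) (v : W) : (join G H).Adj (Sum.inl u) (Sum.inr v) := by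
  simp [join]

theorem join_adj_inr_inl (u : W) (v : V) : (join G H).Adj (Sum.inr u) (Sum.inl v) := by
  simp [join]

end Join

/-! ### Lower bounds for the spectral radii of the extremal graphs. -/

section ExtremalRho

open Classical Matrix

theorem sum_ite_eq_zero_else {ι : Type*} [Fintype ι] (i : ι) {_ : ∀ j, Decidable (i = j)} (c : ℝ) :
    (∑ j, if i = j then 0 else c) = (Fintype.card ι - 1) * c := by
  have h : ∀ j, (if i = j then 0 else c) = c - @ite _ (i = j) (Classical.propDecidable _) c 0 :=
    fun j => by split_ifs <;> simp
  simp only [h, Finset.sum_sub_distrib, Finset.sum_ite_eq]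
  simp
  ring

theorem sub_two_le_rho_pendantGraph (n : ℕ) (hn : 4 ≤ n) : (n : ℝ) - 2 ≤ rho (pendantGraph n) := by
  -- The test vector is the indicator of the clique on n - 1 vertices, whose Rayleigh quotient is n
  -- - 2.
  refine le_rho_of_rayleigh (x := Sum.elim (fun _ => 1) (Sum.elim (fun _ => 1) (fun _ => 0))) _ ?_ ?_
  · intro h
    simpa using congrFun h (Sum.inl 0)
  · have hc : ((n - 2 : ℕ) : ℝ) = n - 2 := by rw [Nat.cast_sub (by omega)]; norm_num
    simp [dotProduct, mulVec, SimpleGraph.adjMatrix_apply, join_adj_inl_inl, join_adj_inl_inr,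
      join_adj_inr_inl, join_adj_inr_inr, -Finset.sum_boole, hc]
    have h : ∀ (i : Fin (n - 2)) (_ : ∀ j, Decidable (i = j)),
        (∑ j, if i = j then 0 else 1 : ℝ) = n - 3 := by
      intro i _
      refine (sum_ite_eq_zero_else i 1).trans ?_
      rw [Fintype.card_fin, hc]
      ring
    refine le_of_eq (Eq.trans ?_ (congrArg (fun t => (n : ℝ) - 2 + t)
      (Finset.sum_congr rfl fun i _ => congrArg (fun t => 1 + t) (h i _).symm)))
    simp [hc]
    ring

/-- The test vector is `a` on the clique and `1` on the independent set; `h` is the Rayleigh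
inequality written out, so a rational `a` near the Perron ratio suffices. -/
theorem le_rho_splitGraph {n s : ℕ} (hs : n / 2 = s) (h0 : 0 < s) {a c : ℝ}
    (h : c * (s * a ^ 2 + s) ≤ s * (a * ((s - 1) * a + s)) + s * (s * a)) :
    c ≤ rho (splitGraph n) := by
  subst hs
  refine le_rho_of_rayleigh (x := Sum.elim (fun _ => a) (fun _ => 1)) _ ?_ ?_
  · intro h
    simpa using congrFun h (Sum.inr ⟨0, h0⟩)
  · simp [dotProduct, mulVec, SimpleGraph.adjMatrix_apply, join_adj_inl_inl, join_adj_inl_inr,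
      join_adj_inr_inl, join_adj_inr_inr, sum_ite_eq_zero_else]
    linarith

/-- The true value is (1 + √17)/2; 5/2 already makes Hong's bound force at least 5 edges. -/
theorem le_rho_splitGraph_four : (5 : ℝ) / 2 ≤ rho (splitGraph 4) :=
  le_rho_splitGraph (s := 2) (a := 3 / 2) (by norm_num) (by norm_num) (by norm_num)

/-- The true value is 1 + √10; 83/20 already makes Hong's bound force at least 12 edges. -/
theorem le_rho_splitGraph_six : (83 : ℝ) / 20 ≤ rho (splitGraph 6) :=
  le_rho_splitGraph (s := 3) (a := 3 / 2) (by norm_num) (by norm_num) (by norm_num)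

end ExtremalRho


/-! ### Barriers and the structure of sets of nonnegative value. -/

section BergeTutte

variable {V : Type*} {k : ℕ}

theorem bergeTutte_of_odd (hk : Odd k) (G : SimpleGraph V) (S : Set V) :
    bergeTutte k G S =
      (oddCount (G.induce Sᶜ) : ℤ) + k * isolatedCount (G.induce Sᶜ) - k * S.ncard := by
  rw [bergeTutte, if_neg (Nat.not_even_iff_odd.2 hk)]

theorem three_le_ncard_of_odd_of_nontrivial [Finite V] {s : Set V} (h1 : Odd s.ncard)
    (h2 : s.Nontrivial) : 3 ≤ s.ncard := by
  have := Set.one_lt_ncard_iff_nontrivial.2 h2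
  obtain ⟨m, hm⟩ := h1
  omega

variable [Fintype V]

theorem oddCount_eq_zero_of_connected {G : SimpleGraph V} (hG : G.Connected)
    (hV : Even (Nat.card V)) : oddCount G = 0 := by
  rw [oddCount, Set.ncard_eq_zero]
  ext c
  simp only [Set.mem_ofPred_eq, Set.mem_empty_iff_false, iff_false, not_and]
  intro hc
  have := hG.preconnected.subsingleton_connectedComponent
  have hs : c.supp = Set.univ := by
    ext v
    simp [SimpleGraph.ConnectedComponent.mem_supp_iff, Subsingleton.elim _ c]
  rw [hs, Set.ncard_univ] at hc
  exact absurd hV (Nat.not_even_iff_odd.2 hc)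

theorem isolatedCount_eq_zero_of_connected [Nontrivial V] {G : SimpleGraph V} (hG : G.Connected) :
    isolatedCount G = 0 := by
  rw [isolatedCount, Set.ncard_eq_zero]
  ext v
  simpa using hG.preconnected.not_isIsolated v

theorem bergeTutte_empty [Nontrivial V] (hk : Odd k) {G : SimpleGraph V} (hG : G.Connected)
    (hV : Even (Nat.card V)) : bergeTutte k G ∅ = 0 := by
  rw [bergeTutte_of_odd hk, Set.compl_empty]
  have hc : (G.induce Set.univ).Connected := (SimpleGraph.induceUnivIso G).connected_iff.2 hG
  have : Nontrivial (Set.univ : Set V) := (Equiv.Set.univ V).nontrivial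
  classical
  rw [oddCount_eq_zero_of_connected hc (by simpa using hV), isolatedCount_eq_zero_of_connected hc]
  simp

theorem isGBC_iff_bergeTutte_neg [Nontrivial V] (hk : Odd k) {G : SimpleGraph V}
    (hG : G.Connected) (hV : Even (Nat.card V)) :
    IsGBC k G ↔ ∀ S : Set V, S.Nonempty → bergeTutte k G S < 0 := by
  have h0 := bergeTutte_empty hk hG hV
  constructor
  · rintro ⟨-, h⟩ S hS
    have hb : IsBarrier k G ∅ := (h ∅).2 rfl
    have h1 := hb S
    rw [h0] at h1
    refine lt_of_le_of_ne h1 fun he => hS.ne_empty ((h S).1 fun T => ?_)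
    rw [he, ← h0]
    exact hb T
  · intro h
    have hle : ∀ T, bergeTutte k G T ≤ 0 := fun T => by
      rcases T.eq_empty_or_nonempty with rfl | hT
      · exact h0.le
      · exact (h T hT).le
    refine ⟨hV, fun S => ⟨fun hS => ?_, ?_⟩⟩
    · by_contra hne
      have h1 := h S (Set.nonempty_iff_ne_empty.2 hne)
      have h2 := hS ∅
      omega
    · rintro rfl T
      rw [h0]
      exact hle T

theorem bergeTutte_nonneg_of_card_le (hk : Odd k) {G : SimpleGraph V} {S I : Set V}
    (hd : Disjoint I S) (hI : ∀ u ∈ I, ∀ v, G.Adj u v → v ∈ S) (hc : S.ncard ≤ I.ncard) :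
    0 ≤ bergeTutte k G S := by
  rw [bergeTutte_of_odd hk]
  have h : I.ncard ≤ isolatedCount (G.induce Sᶜ) := by
    rw [isolatedCount, ← Set.ncard_image_of_injective _ Subtype.val_injective]
    refine Set.ncard_le_ncard ?_ (Set.toFinite _)
    intro u hu
    refine ⟨⟨u, Set.disjoint_left.1 hd hu⟩, fun w hw => w.2 (hI u hu w hw), rfl⟩
  have h2 : (k : ℤ) * S.ncard ≤ k * isolatedCount (G.induce Sᶜ) :=
    mul_le_mul_of_nonneg_left (by exact_mod_cast hc.trans h) (by positivity)
  have h3 : (0 : ℤ) ≤ oddCount (G.induce Sᶜ) := by positivity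
  linarith

/-- Nontrivial odd components have at least three vertices each, and avoid isolated vertices. -/
theorem isolatedCount_add_three_mul_oddCount_le {W : Type*} [Fintype W] (H : SimpleGraph W) :
    isolatedCount H + 3 * oddCount H ≤ Fintype.card W := by
  classical
  set Q : Set H.ConnectedComponent := {c | c ∈ H.oddComponents ∧ c.supp.Nontrivial} with hQ
  have hQf : Q.Finite := Set.toFinite _
  have h3 : ∀ c ∈ hQf.toFinset, 3 ≤ c.supp.toFinset.card := by
    intro c hc
    obtain ⟨h1, h2⟩ := hQf.mem_toFinset.1 hc
    rw [← Set.ncard_eq_toFinset_card']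
    exact three_le_ncard_of_odd_of_nontrivial h1 h2
  have hcard : (hQf.toFinset.biUnion fun c => c.supp.toFinset).card =
      ∑ c ∈ hQf.toFinset, c.supp.toFinset.card := by
    refine Finset.card_biUnion fun c _ d _ hcd => ?_
    exact Set.disjoint_toFinset.2 <| H.pairwise_disjoint_supp_connectedComponent hcd
  have hge := Finset.card_nsmul_le_sum hQf.toFinset _ 3 h3
  have hdisj : Disjoint (Set.toFinset {v | H.IsIsolated v})
      (hQf.toFinset.biUnion fun c => c.supp.toFinset) := by
    rw [Finset.disjoint_left]
    intro v hv hv'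
    simp only [Set.mem_toFinset, Set.mem_ofPred_eq] at hv
    obtain ⟨c, hc, hvc⟩ := Finset.mem_biUnion.1 hv'
    obtain ⟨-, h2⟩ := hQf.mem_toFinset.1 hc
    rw [Set.mem_toFinset] at hvc
    obtain ⟨w, hw, hwv⟩ := h2.exists_ne v
    have hr := c.reachable_of_mem_supp hvc hw
    exact H.mem_support_iff_not_isIsolated.1
      (SimpleGraph.mem_support_of_reachable hwv.symm hr) hv
  have hle := Finset.card_le_univ (Set.toFinset {v | H.IsIsolated v} ∪
    hQf.toFinset.biUnion fun c => c.supp.toFinset)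
  rw [Finset.card_union_of_disjoint hdisj, hcard] at hle
  rw [isolatedCount, oddCount, ← hQ, Set.ncard_eq_toFinset_card', Set.ncard_eq_toFinset_card _ hQf]
  simp only [smul_eq_mul] at hge
  omega

/-- A nonempty set where the Berge–Tutte expression is nonnegative either has at least as many
isolated vertices in its complement, or separates the graph into two large parts. -/
theorem exists_of_bergeTutte_nonneg (hk3 : 3 ≤ k) (hk : Odd k) {G : SimpleGraph V} {S : Finset V}
    (h : 0 ≤ bergeTutte k G S) :
    (∃ I : Finset V, Disjoint I S ∧ (∀ u ∈ I, ∀ v, G.Adj u v → v ∈ S) ∧ I.card = S.card) ∨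
    ∃ A B : Finset V, Disjoint A B ∧ (∀ u ∈ A, ∀ v ∈ B, ¬ G.Adj u v) ∧ 3 ≤ A.card ∧ 3 ≤ B.card ∧
      A.card + B.card + S.card = Fintype.card V ∧ S.card + 8 ≤ A.card + B.card := by
  classical
  rw [bergeTutte_of_odd hk, Set.ncard_coe_finset] at h
  set H := G.induce (S : Set V)ᶜ with hH
  by_cases hi : S.card ≤ isolatedCount H
  · left
    set J : Finset V := (Set.toFinset {v | H.IsIsolated v}).map (Function.Embedding.subtype _)
    have hJ : S.card ≤ J.card := by
      rwa [Finset.card_map, ← Set.ncard_eq_toFinset_card']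
    obtain ⟨I, hIJ, hIc⟩ := Finset.exists_subset_card_eq hJ
    have hJm : ∀ u ∈ I, ∃ hu : u ∉ S, H.IsIsolated ⟨u, by simpa using hu⟩ := by
      intro u hu
      obtain ⟨w, hw, rfl⟩ := Finset.mem_map.1 (hIJ hu)
      refine ⟨fun h => w.2 h, by simpa using hw⟩
    refine ⟨I, Finset.disjoint_left.2 fun u hu => (hJm u hu).1, fun u hu v huv => ?_, hIc⟩
    by_contra hv
    obtain ⟨hu', hiso⟩ := hJm u hu
    exact hiso ⟨v, by simpa using hv⟩ huv
  · right
    push Not at hi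
    have hcard : Fintype.card ((S : Set V)ᶜ : Set V) + S.card = Fintype.card V := by
      rw [Fintype.card_compl_set]
      simp only [Finset.coe_sort_coe, Fintype.card_coe]
      have := S.card_le_univ
      omega
    -- With i < s isolated vertices and q nontrivial odd components, q ≥ 3(s - i), so |H| ≥ i + 3q ≥
    -- s + 8(s - i) ≥ s + 8.
    have hN := isolatedCount_add_three_mul_oddCount_le H
    have hq : 3 * (S.card - isolatedCount H) ≤ oddCount H := by
      have h1 : k * S.card ≤ oddCount H + k * isolatedCount H := by zify; linarith
      have h2 : k * (S.card - isolatedCount H) ≤ oddCount H := by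
        rw [Nat.mul_sub]; omega
      exact (Nat.mul_le_mul_right _ hk3).trans h2
    have h1q : 1 < oddCount H := by omega
    rw [oddCount, Set.one_lt_ncard] at h1q
    obtain ⟨c, hc, d, hd, hcd⟩ := h1q
    have h3 : ∀ c ∈ {c : H.ConnectedComponent | c ∈ H.oddComponents ∧ c.supp.Nontrivial},
        3 ≤ c.supp.toFinset.card := by
      rintro c ⟨h1, h2⟩
      rw [← Set.ncard_eq_toFinset_card']
      exact three_le_ncard_of_odd_of_nontrivial h1 h2
    have hdc : d.supp.toFinset ⊆ c.supp.toFinsetᶜ := by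
      intro v hv
      rw [Finset.mem_compl, Set.mem_toFinset]
      rw [Set.mem_toFinset] at hv
      exact fun hv' => hcd (SimpleGraph.ConnectedComponent.eq_of_common_vertex hv' hv)
    have hAB := Finset.card_add_card_compl c.supp.toFinset
    -- One odd component against the rest of `H`; the rest contains a second odd component `d`,
    -- hence at least three vertices.
    refine ⟨c.supp.toFinset.map (Function.Embedding.subtype _),
      c.supp.toFinsetᶜ.map (Function.Embedding.subtype _), ?_, ?_, ?_, ?_, ?_, ?_⟩
    · rw [Finset.disjoint_map]
      exact disjoint_compl_right
    · intro u hu v hv huv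
      obtain ⟨u, hu', rfl⟩ := Finset.mem_map.1 hu
      obtain ⟨v, hv', rfl⟩ := Finset.mem_map.1 hv
      rw [Finset.mem_compl, Set.mem_toFinset] at hv'
      rw [Set.mem_toFinset] at hu'
      exact hv' (c.mem_supp_of_adj_mem_supp hu' huv)
    · rw [Finset.card_map]; exact h3 c hc
    · rw [Finset.card_map]; exact (h3 d hd).trans (Finset.card_le_card hdc)
    · simp only [Finset.card_map]; omega
    · simp only [Finset.card_map]; omega

end BergeTutte

/-! ### Degree sums of separated graphs and of `barrierGraph`. -/

section DegreeSum

open Classical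

variable {V : Type*} [Fintype V]

theorem sum_degree_add_le_of_separated {G : SimpleGraph V} {A B : Finset V} (hAB : Disjoint A B)
    (h : ∀ u ∈ A, ∀ v ∈ B, ¬ G.Adj u v) :
    ∑ v, G.degree v + Fintype.card V + 2 * (A.card * B.card) ≤ Fintype.card V * Fintype.card V := by
  -- A vertex of `A` misses itself and all of `B`, and symmetrically.
  have hv : ∀ v, G.degree v + 1 + ((if v ∈ A then B.card else 0) + (if v ∈ B then A.card else 0)) ≤
      Fintype.card V := by
    have key : ∀ v (C : Finset V), v ∉ C → (∀ w ∈ C, ¬ G.Adj v w) →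
        G.degree v + 1 + C.card ≤ Fintype.card V := by
      intro v C hvC hC
      have hd : Disjoint (insert v (G.neighborFinset v)) C := by
        rw [Finset.disjoint_left]
        intro w hw hwC
        rcases Finset.mem_insert.1 hw with rfl | hw
        · exact hvC hwC
        · exact hC w hwC ((G.mem_neighborFinset v w).1 hw)
      have := Finset.card_le_univ (insert v (G.neighborFinset v) ∪ C)
      rwa [Finset.card_union_of_disjoint hd, Finset.card_insert_of_notMem (by simp),
        SimpleGraph.card_neighborFinset_eq_degree] at this
    intro v
    by_cases hA : v ∈ A
    · have hB := Finset.disjoint_left.1 hAB hA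
      simpa [hA, hB] using key v B hB (h v hA)
    · by_cases hB : v ∈ B
      · simpa [hA, hB] using key v A hA fun w hw hvw => h w hw v hB hvw.symm
      · simpa [hA, hB] using key v ∅ (by simp) (by simp)
  have := Finset.sum_le_sum fun v (_ : v ∈ Finset.univ) => hv v
  simp [Finset.sum_add_distrib] at this
  linarith [Nat.mul_comm A.card B.card]

/-- The graph in which the vertices of `I` are adjacent exactly to those of `S`, and all other
pairs of distinct vertices are adjacent. -/
def barrierGraph {V : Type*} (S I : Finset V) : SimpleGraph V where
  Adj u v := u ≠ v ∧ (u ∈ I → v ∈ S) ∧ (v ∈ I → u ∈ S)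
  symm := ⟨fun _ _ h => ⟨h.1.symm, h.2.2, h.2.1⟩⟩
  loopless := ⟨fun _ h => h.1 rfl⟩

theorem barrierGraph_adj {V : Type*} (S I : Finset V) (u v : V) :
    (barrierGraph S I).Adj u v ↔ u ≠ v ∧ (u ∈ I → v ∈ S) ∧ (v ∈ I → u ∈ S) := Iff.rfl

theorem neighborFinset_barrierGraph_of_mem_left {S I : Finset V} (hd : Disjoint I S) {v : V}
    (hv : v ∈ S) : (barrierGraph S I).neighborFinset v = Finset.univ.erase v := by
  ext w
  have := fun h => Finset.disjoint_left.1 hd h hv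
  rw [SimpleGraph.mem_neighborFinset, barrierGraph_adj, Finset.mem_erase]
  simp only [Finset.mem_univ]
  tauto

theorem neighborFinset_barrierGraph_of_mem_right {S I : Finset V} (hd : Disjoint I S) {v : V}
    (hv : v ∈ I) : (barrierGraph S I).neighborFinset v = S := by
  ext w
  have h1 := fun h => Finset.disjoint_left.1 hd hv h
  have h2 : w ∈ S → v ≠ w := by rintro h rfl; exact h1 h
  have h3 : w ∈ I → w ∉ S := fun h => Finset.disjoint_left.1 hd h
  rw [SimpleGraph.mem_neighborFinset, barrierGraph_adj]
  tauto

theorem sum_degree_barrierGraph {S I : Finset V} (hd : Disjoint I S) (hc : I.card = S.card) :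
    (∑ v, (barrierGraph S I).degree v : ℤ) =
      S.card * (Fintype.card V - 1) + S.card * S.card +
        (Fintype.card V - 2 * S.card) * (Fintype.card V - S.card - 1) := by
  have hS : ∀ v ∈ S, ((barrierGraph S I).degree v : ℤ) = Fintype.card V - 1 := by
    intro v hv
    rw [← SimpleGraph.card_neighborFinset_eq_degree, neighborFinset_barrierGraph_of_mem_left hd hv,
      Finset.cast_card_erase_of_mem (by simp)]
    simp
  have hI : ∀ v ∈ I, ((barrierGraph S I).degree v : ℤ) = S.card := by
    intro v hv
    rw [← SimpleGraph.card_neighborFinset_eq_degree, neighborFinset_barrierGraph_of_mem_right hd hv]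
  have hR : ∀ v ∈ (S ∪ I)ᶜ, ((barrierGraph S I).degree v : ℤ) = Fintype.card V - S.card - 1 := by
    intro v hv
    have : (barrierGraph S I).neighborFinset v = Iᶜ.erase v := by
      ext w
      rw [Finset.mem_compl, Finset.mem_union] at hv
      rw [SimpleGraph.mem_neighborFinset, barrierGraph_adj, Finset.mem_erase, Finset.mem_compl]
      tauto
    rw [← SimpleGraph.card_neighborFinset_eq_degree, this,
      Finset.cast_card_erase_of_mem (by simp at hv; simp [hv]), Finset.card_compl,
      Nat.cast_sub (Finset.card_le_univ _), hc]
  rw [← Finset.sum_add_sum_compl (S ∪ I), Finset.sum_union hd.symm, Finset.sum_congr rfl hS,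
    Finset.sum_congr rfl hI, Finset.sum_congr rfl hR]
  simp only [Finset.sum_const, nsmul_eq_mul]
  rw [Finset.card_compl, Nat.cast_sub (Finset.card_le_univ _),
    Finset.card_union_of_disjoint hd.symm, hc]
  push_cast
  ring

theorem sum_degree_le_of_le {G H : SimpleGraph V} (h : G ≤ H) :
    ∑ v, G.degree v ≤ ∑ v, H.degree v :=
  Finset.sum_le_sum fun _ _ => SimpleGraph.degree_le_of_le h

theorem eq_of_le_of_sum_degree_le {G H : SimpleGraph V} (h : G ≤ H)
    (hd : ∑ v, H.degree v ≤ ∑ v, G.degree v) : G = H := by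
  rw [SimpleGraph.sum_degrees_eq_twice_card_edges, SimpleGraph.sum_degrees_eq_twice_card_edges] at hd
  exact SimpleGraph.edgeFinset_inj.1 (Finset.eq_of_subset_of_card_le
    (SimpleGraph.edgeFinset_subset_edgeFinset.2 h) (by omega))

end DegreeSum


/-! ### `barrierGraph` as a maximal graph, and its extremal cases. -/

section BarrierGraph

variable {V : Type*}

theorem le_barrierGraph {G : SimpleGraph V} {S I : Finset V}
    (h : ∀ u ∈ I, ∀ v, G.Adj u v → v ∈ S) : G ≤ barrierGraph S I :=
  fun u v huv => ⟨huv.ne, fun hu => h u hu v huv, fun hv => h v hv u huv.symm⟩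

variable [Fintype V]

open Classical in
-- This graph, K₄ ∨ 4K₁, passes the edge count at n = 8, so it needs a direct bound below n - 2 = 6.
-- The weight 7/5 approximates its Perron ratio.
theorem rho_barrierGraph_le_of_card_eq_eight {S I : Finset V} (hd : Disjoint I S)
    (hS : S.card = 4) (hI : I.card = 4) (hV : Fintype.card V = 8) :
    rho (barrierGraph S I) ≤ 59 / 10 := by
  have : Nonempty V := Fintype.card_pos_iff.1 (by omega)
  have hu : S ∪ I = Finset.univ := Finset.eq_univ_of_card _ (by
    rw [Finset.card_union_of_disjoint hd.symm]; omega)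
  have hsum : ∑ v ∈ S, (if v ∈ S then (7 : ℝ) / 5 else 1) = 28 / 5 := by
    rw [Finset.sum_congr rfl fun v hv => if_pos hv]
    simp [hS]; norm_num
  have hsumI : ∑ v ∈ I, (if v ∈ S then (7 : ℝ) / 5 else 1) = 4 := by
    rw [Finset.sum_congr rfl fun v hv => if_neg (Finset.disjoint_left.1 hd hv)]
    simp [hI]
  refine rho_le_of_mulVec_le _ (y := fun v => if v ∈ S then 7 / 5 else 1) ?_ ?_
  · intro v
    split_ifs <;> norm_num
  · intro v
    rw [SimpleGraph.adjMatrix_mulVec_apply]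
    rcases Finset.mem_union.1 (hu ▸ Finset.mem_univ v) with hv | hv
    · rw [neighborFinset_barrierGraph_of_mem_left hd hv, Finset.sum_erase_eq_sub (by simp), ← hu,
        Finset.sum_union hd.symm, hsum, hsumI, if_pos hv]
      norm_num
    · rw [neighborFinset_barrierGraph_of_mem_right hd hv, hsum,
        if_neg (Finset.disjoint_left.1 hd hv)]
      norm_num

theorem nonempty_barrierGraph_iso_splitGraph {S I : Finset V} {n : ℕ} (hd : Disjoint I S)
    (hV : Fintype.card V = n) (hS : S.card = n / 2) (hI : I.card = n / 2) (hn : Even n) :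
    Nonempty (barrierGraph S I ≃g splitGraph n) := by
  let eS := (Finset.equivFinOfCardEq hS).symm
  let eI := (Finset.equivFinOfCardEq hI).symm
  let f : Fin (n / 2) ⊕ Fin (n / 2) → V := Sum.elim (fun i => eS i) (fun i => eI i)
  have hne : ∀ i j, (eS i : V) ≠ eI j := fun i j h =>
    Finset.disjoint_left.1 hd (eI j).2 (h ▸ (eS i).2)
  have hS' : ∀ i, (eS i : V) ∉ I := fun i h => Finset.disjoint_left.1 hd h (eS i).2
  have hI' : ∀ i, (eI i : V) ∉ S := fun i h => Finset.disjoint_left.1 hd (eI i).2 h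
  have hf : Function.Injective f :=
    (Subtype.val_injective.comp eS.injective).sumElim (Subtype.val_injective.comp eI.injective) hne
  have hb : Function.Bijective f := by
    refine (Fintype.bijective_iff_injective_and_card f).2 ⟨hf, ?_⟩
    obtain ⟨m, hm⟩ := hn
    simp only [Fintype.card_sum, Fintype.card_fin]
    omega
  refine ⟨RelIso.symm ⟨Equiv.ofBijective f hb, ?_⟩⟩
  rintro (i | i) (j | j) <;>
    simp [f, barrierGraph_adj, join_adj_inl_inl, join_adj_inl_inr, join_adj_inr_inl,
      join_adj_inr_inr, hne, hS', hI', (hne _ _).symm, Subtype.ext_iff.symm]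

theorem nonempty_barrierGraph_iso_pendantGraph {S I : Finset V} {n : ℕ} (hd : Disjoint I S)
    (hV : Fintype.card V = n) (hS : S.card = 1) (hI : I.card = 1) (hn : 2 ≤ n) :
    Nonempty (barrierGraph S I ≃g pendantGraph n) := by
  classical
  have hR : (S ∪ I)ᶜ.card = n - 2 := by
    rw [Finset.card_compl, Finset.card_union_of_disjoint hd.symm]; omega
  let eS := (Finset.equivFinOfCardEq hS).symm
  let eI := (Finset.equivFinOfCardEq hI).symm
  let eR := (Finset.equivFinOfCardEq hR).symm
  let f : Fin 1 ⊕ (Fin (n - 2) ⊕ Fin 1) → V :=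
    Sum.elim (fun i => eS i) (Sum.elim (fun i => eR i) (fun i => eI i))
  have hRS : ∀ i, (eR i : V) ∉ S := fun i h =>
    Finset.mem_compl.1 (eR i).2 (Finset.mem_union_left _ h)
  have hRI : ∀ i, (eR i : V) ∉ I := fun i h =>
    Finset.mem_compl.1 (eR i).2 (Finset.mem_union_right _ h)
  have hS' : ∀ i, (eS i : V) ∉ I := fun i h => Finset.disjoint_left.1 hd h (eS i).2
  have hI' : ∀ i, (eI i : V) ∉ S := fun i h => Finset.disjoint_left.1 hd (eI i).2 h
  have hSI : ∀ i j, (eS i : V) ≠ eI j := fun i j h => hI' j (h ▸ (eS i).2)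
  have hSR : ∀ i j, (eS i : V) ≠ eR j := fun i j h => hRS j (h ▸ (eS i).2)
  have hRI' : ∀ i j, (eR i : V) ≠ eI j := fun i j h => hRI i (h ▸ (eI j).2)
  have hf : Function.Injective f := by
    refine (Subtype.val_injective.comp eS.injective).sumElim
      ((Subtype.val_injective.comp eR.injective).sumElim
        (Subtype.val_injective.comp eI.injective) hRI') ?_
    rintro i (j | j)
    exacts [hSR i j, hSI i j]
  have hb : Function.Bijective f := by
    refine (Fintype.bijective_iff_injective_and_card f).2 ⟨hf, ?_⟩
    simp only [Fintype.card_sum, Fintype.card_fin]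
    omega
  refine ⟨RelIso.symm ⟨Equiv.ofBijective f hb, ?_⟩⟩
  rintro (i | i | i) (j | j | j) <;>
    simp [f, barrierGraph_adj, join_adj_inl_inl, join_adj_inl_inr, join_adj_inr_inl,
      join_adj_inr_inr, hS', hI', hRS, hRI, hSI, hSR, hRI', (hSI _ _).symm, (hSR _ _).symm,
      (hRI' _ _).symm, Subtype.ext_iff.symm, eq_iff_true_of_subsingleton]

end BarrierGraph

/-! ### The exceptional graphs and the two ranges of n. -/

section Main

variable {V : Type*} [Fintype V] {k n : ℕ} {G : SimpleGraph V}

theorem not_isGBC_of_iso_pendantGraph [Nontrivial V] (hk : Odd k) (hG : G.Connected)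
    (hV : Even (Nat.card V)) (e : G ≃g pendantGraph n) : ¬ IsGBC k G := by
  rw [isGBC_iff_bergeTutte_neg hk hG hV]
  intro h
  -- The cut vertex is `S`, and the pendant vertex is isolated once it is removed.
  refine (h {e.symm (Sum.inl 0)} (Set.singleton_nonempty _)).not_ge
    (bergeTutte_nonneg_of_card_le hk (I := {e.symm (Sum.inr (Sum.inr 0))}) ?_ ?_ ?_)
  · simp
  · rintro u rfl v huv
    have h1 := e.map_adj_iff.2 huv
    rw [e.apply_symm_apply] at h1
    rw [Set.mem_singleton_iff, ← e.symm_apply_apply v]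
    congr 1
    rcases hv : e v with i | i | i
    · rw [Subsingleton.elim i 0]
    · simp [hv, join_adj_inr_inr] at h1
    · simp [hv, Subsingleton.elim i 0] at h1
  · simp

theorem not_isGBC_of_iso_splitGraph [Nontrivial V] (hk : Odd k) (hG : G.Connected)
    (hV : Even (Nat.card V)) (hn : 2 ≤ n) (e : G ≃g splitGraph n) : ¬ IsGBC k G := by
  rw [isGBC_iff_bergeTutte_neg hk hG hV]
  intro h
  refine (h ((fun i => e.symm (Sum.inl i)) '' Set.univ)
    ⟨_, ⟨0, by omega⟩, trivial, rfl⟩).not_ge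
    (bergeTutte_nonneg_of_card_le hk (I := (fun i => e.symm (Sum.inr i)) '' Set.univ) ?_ ?_ ?_)
  · rw [Set.disjoint_left]
    rintro _ ⟨i, -, rfl⟩ ⟨j, -, h⟩
    simp at h
  · rintro _ ⟨i, -, rfl⟩ v huv
    have h1 := e.map_adj_iff.2 huv
    rw [e.apply_symm_apply] at h1
    rcases hv : e v with j | j
    · exact ⟨j, trivial, by simp [← hv]⟩
    · simp [hv, join_adj_inr_inr] at h1
  · exact ((Set.ncard_image_of_injective _ (e.symm.injective.comp Sum.inl_injective)).trans
      (Set.ncard_image_of_injective _ (e.symm.injective.comp Sum.inr_injective)).symm).le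

open Classical in
theorem rho_sq_le_of_connected [Nontrivial V] (hG : G.Connected) :
    rho G ^ 2 ≤ (∑ u, G.degree u : ℕ) - (Fintype.card V : ℝ) + 1 := by
  refine rho_sq_le G fun v => ?_
  obtain ⟨w, hw⟩ := hG.preconnected.exists_adj_of_nontrivial v
  exact (G.degree_pos_iff_exists_adj v).2 ⟨w, hw⟩

open Classical in
theorem iso_pendantGraph_of_not_isGBC [Nontrivial V] (hk3 : 3 ≤ k) (hk : Odd k) (hG : G.Connected)
    (hV : Fintype.card V = n) (hn : Even n) (hn8 : 8 ≤ n)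
    (hr : rho (pendantGraph n) ≤ rho G) (h : ¬ IsGBC k G) : Nonempty (G ≃g pendantGraph n) := by
  rw [isGBC_iff_bergeTutte_neg hk hG (by rwa [Nat.card_eq_fintype_card, hV])] at h
  push Not at h
  obtain ⟨S, hSne, hS⟩ := h
  lift S to Finset V using Set.toFinite S
  have hS1 : 1 ≤ S.card := Finset.card_pos.2 (by simpa using hSne)
  have hρ := (sub_two_le_rho_pendantGraph n (by omega)).trans hr
  have hHong := rho_sq_le_of_connected hG
  have h8 : (8 : ℝ) ≤ n := by exact_mod_cast hn8
  have hdeg : (n : ℤ) * n + 3 ≤ (∑ u, G.degree u : ℕ) + 3 * n := by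
    have h1 : ((n : ℝ) - 2) ^ 2 ≤ rho G ^ 2 := pow_le_pow_left₀ (by linarith) hρ 2
    rw [hV] at hHong
    have h2 : (n : ℝ) * n + 3 ≤ (∑ u, G.degree u : ℕ) + 3 * n := by linarith
    exact_mod_cast h2
  rcases exists_of_bergeTutte_nonneg hk3 hk hS with ⟨I, hd, hI, hc⟩ | ⟨A, B, hd, hAB, hA, hB, hc, hs⟩
  · have hle := le_barrierGraph hI
    have hD := sum_degree_barrierGraph hd hc
    have hDle := sum_degree_le_of_le hle
    have heven := G.sum_degrees_eq_twice_card_edges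
    have h2s : 2 * S.card ≤ n := by
      have := Finset.card_le_univ (S ∪ I)
      rw [Finset.card_union_of_disjoint hd.symm] at this
      omega
    rw [hV] at hD
    have hDle' : ((∑ v, G.degree v : ℕ) : ℤ) ≤ ∑ v, ((barrierGraph S I).degree v : ℤ) := by
      exact_mod_cast hDle
    obtain ⟨m, rfl⟩ := hn
    by_cases h1 : S.card = 1
    · have heq : G = barrierGraph S I := by
        refine eq_of_le_of_sum_degree_le hle ?_
        rw [heven] at hdeg ⊢
        zify
        rw [hD, h1]
        push_cast at hdeg ⊢
        -- Parity of the degree sum gains the missing unit, from n² - 3n + 3 to n² - 3n + 4.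
        have : (2 : ℤ) * (2 * m * m - 3 * m + 1) < 2 * G.edgeFinset.card := by linarith
        have := lt_of_mul_lt_mul_left this (by norm_num)
        linarith
      rw [heq]
      exact nonempty_barrierGraph_iso_pendantGraph hd hV h1 (hc.trans h1) (by omega)
    · exfalso
      -- This is the degree sum of `barrierGraph S I` compared with n² - 3n + 3, where n = 2m.
      have hkey : ((S.card : ℤ) - 1) * (4 * m - 3 * S.card - 4) ≤ 1 := by
        push_cast at hD hdeg hDle'
        linarith
      have hs2 : 2 ≤ S.card := by omega
      have hm4 : m = 4 ∧ S.card = 4 := by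
        by_cases h5 : 5 ≤ m
        · exfalso
          have e1 : (2 : ℤ) ≤ 2 * (4 * m - 3 * S.card - 4) := by omega
          have e2 : (1 : ℤ) ≤ S.card - 1 := by omega
          rcases (show S.card = 2 ∨ 3 ≤ S.card by omega) with h2 | h3
          · rw [h2] at hkey; push_cast at hkey; omega
          · have e3 : (2 : ℤ) ≤ S.card - 1 := by omega
            nlinarith
        · have : m = 4 := by omega
          subst this
          have : S.card ≤ 4 := by omega
          interval_cases hh : S.card
          · norm_num at hkey
          · norm_num at hkey
          · exact ⟨rfl, rfl⟩
      obtain ⟨rfl, hs4⟩ := hm4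
      have heq : G = barrierGraph S I := by
        refine eq_of_le_of_sum_degree_le hle ?_
        rw [heven] at hdeg ⊢
        zify
        rw [hD, hs4]
        push_cast at hdeg ⊢
        omega
      have := rho_barrierGraph_le_of_card_eq_eight hd hs4 (hc.trans hs4) hV
      rw [← heq] at this
      norm_num at hρ
      linarith
  · exfalso
    have hD := sum_degree_add_le_of_separated hd hAB
    rw [hV] at hD hc
    have hD' : ((∑ v, G.degree v : ℕ) : ℤ) + n + 2 * (A.card * B.card) ≤ n * n := by
      exact_mod_cast hD
    have hA' : (0 : ℤ) ≤ (A.card : ℤ) - 3 := by omega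
    have hB' : (0 : ℤ) ≤ (B.card : ℤ) - 3 := by omega
    -- Since |A| + |B| ≥ (n + 8)/2, this gives 2|A||B| ≥ 6(|A| + |B|) - 18 ≥ 3n + 6, whereas the
    -- edge count allows at most 2n - 3.
    have hAB3 := mul_nonneg hA' hB'
    have hc' : (A.card : ℤ) + B.card + S.card = n := by exact_mod_cast hc
    have hs' : (S.card : ℤ) + 8 ≤ A.card + B.card := by exact_mod_cast hs
    linarith

open Classical in
theorem iso_splitGraph_of_not_isGBC [Nontrivial V] (hk3 : 3 ≤ k) (hk : Odd k) (hG : G.Connected)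
    (hV : Fintype.card V = n) (hn : Even n) (hn4 : 4 ≤ n) (hn6 : n ≤ 6)
    (hr : rho (splitGraph n) ≤ rho G) (h : ¬ IsGBC k G) : Nonempty (G ≃g splitGraph n) := by
  rw [isGBC_iff_bergeTutte_neg hk hG (by rwa [Nat.card_eq_fintype_card, hV])] at h
  push Not at h
  obtain ⟨S, hSne, hS⟩ := h
  lift S to Finset V using Set.toFinite S
  have hS1 : 1 ≤ S.card := Finset.card_pos.2 (by simpa using hSne)
  have hHong := rho_sq_le_of_connected hG
  have heven := G.sum_degrees_eq_twice_card_edges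
  have hn46 : n = 4 ∨ n = 6 := by
    obtain ⟨m, rfl⟩ := hn
    omega
  -- The left side is the degree sum of `splitGraph n`, namely 10 or 24.
  have hdeg : n * n - n - n * (n - 2) / 4 ≤ ∑ u, G.degree u := by
    rw [heven, hV] at hHong
    rw [heven]
    rcases hn46 with rfl | rfl
    · have h1 := pow_le_pow_left₀ (by norm_num) (le_rho_splitGraph_four.trans hr) 2
      have h2 : (4 : ℝ) < G.edgeFinset.card := by
        push_cast at hHong
        linarith
      have h3 : 4 < G.edgeFinset.card := by exact_mod_cast h2
      omega
    · have h1 := pow_le_pow_left₀ (by norm_num) (le_rho_splitGraph_six.trans hr) 2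
      have h2 : (11 : ℝ) < G.edgeFinset.card := by
        push_cast at hHong
        linarith
      have h3 : 11 < G.edgeFinset.card := by exact_mod_cast h2
      omega
  rcases exists_of_bergeTutte_nonneg hk3 hk hS with ⟨I, hd, hI, hc⟩ | ⟨A, B, hd, hAB, hA, hB, hc, hs⟩
  · have hle := le_barrierGraph hI
    have hD := sum_degree_barrierGraph hd hc
    have hDle := sum_degree_le_of_le hle
    have h2s : 2 * S.card ≤ n := by
      have := Finset.card_le_univ (S ∪ I)
      rw [Finset.card_union_of_disjoint hd.symm] at this
      omega
    rw [hV] at hD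
    have hSn : S.card = n / 2 := by
      rcases hn46 with rfl | rfl
      · have : S.card ≤ 2 := by omega
        interval_cases hh : S.card
        · zify at hDle hdeg
          norm_num at hD hdeg
          omega
        · rfl
      · have : S.card ≤ 3 := by omega
        interval_cases hh : S.card
        · zify at hDle hdeg
          norm_num at hD hdeg
          omega
        · zify at hDle hdeg
          norm_num at hD hdeg
          omega
        · rfl
    have heq : G = barrierGraph S I := by
      refine eq_of_le_of_sum_degree_le hle (le_trans ?_ hdeg)
      zify
      rw [hD, hSn]
      rcases hn46 with rfl | rfl <;> norm_num
    rw [heq]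
    exact nonempty_barrierGraph_iso_splitGraph hd hV hSn (hc.trans hSn) hn
  -- Separation needs |A| + |B| ≥ 9 > n.
  · omega

end Main

end GenBicritical

theorem theorem4p2 {V : Type*} [Fintype V] (G : SimpleGraph V) (hG : G.Connected)
    (n k : ℕ) (hV : Fintype.card V = n) (hn : 4 ≤ n) (hn2 : Even n) (hk : 3 ≤ k) (hk2 : Odd k) :
    (8 ≤ n → GenBicritical.rho (GenBicritical.pendantGraph n) ≤ GenBicritical.rho G →
      (GenBicritical.IsGBC k G ↔ ¬ Nonempty (G ≃g GenBicritical.pendantGraph n))) ∧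
    (n ≤ 6 → GenBicritical.rho (GenBicritical.splitGraph n) ≤ GenBicritical.rho G →
      (GenBicritical.IsGBC k G ↔ ¬ Nonempty (G ≃g GenBicritical.splitGraph n))) := by
  have : Nontrivial V := Fintype.one_lt_card_iff_nontrivial.1 (by omega)
  have hV' : Even (Nat.card V) := by rwa [Nat.card_eq_fintype_card, hV]
  refine ⟨fun h8 hr => ⟨?_, fun h => ?_⟩, fun h6 hr => ⟨?_, fun h => ?_⟩⟩
  · rintro h ⟨e⟩
    exact GenBicritical.not_isGBC_of_iso_pendantGraph hk2 hG hV' e h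
  · by_contra hG'
    exact h (GenBicritical.iso_pendantGraph_of_not_isGBC hk hk2 hG hV hn2 h8 hr hG')
  · rintro h ⟨e⟩
    exact GenBicritical.not_isGBC_of_iso_splitGraph hk2 hG hV' (by omega) e h
  · by_contra hG'
    exact h (GenBicritical.iso_splitGraph_of_not_isGBC hk hk2 hG hV hn2 hn h6 hr hG')
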